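/- Let $\mathfrak g$ be a finite-dimensional simple complex Lie algebra, $\kappa$ the opposite of its Killing form, $\tau$ an antilinear involutive automorphism of $\mathfrak g$ defining a real form, $(I_a)$ a basis of $\mathfrak g$ fixed by $\tau$, $(I^a)$ its $\kappa$-dual basis and $C_{12}=\sum_a I_a\otimes I^a$. **Parameters.** Let $\Sigma$ be a finite set of sites with an involution $\alpha\mapsto\bar\alpha$. Each site $\alpha$ carries a multiplicity $m_\alpha\ge 1$, levels $\ell^\alpha_p\in\mathbb C$ ($0\le p<m_\alpha$) with $\ell^\alpha_{m_\alpha-1}\ne 0$, and a position $z_\alpha\in\mathbb C$, the positions being pairwise distinct and $m_{\bar\alpha}=m_\alpha$, $\ell^{\bar\alpha}_p=\overline{\ell^\alpha_p}$, $z_{\bar\alpha}=\overline{z_\alpha}$. Let $\ell^\infty\in\mathbb R\setminus\{0\}$ and $$\varphi(z)=\sum_{\alpha}\sum_{p=0}^{m_\alpha-1}\frac{\ell^\alpha_p}{(z-z_\alpha)^{p+1}}-\ell^\infty .$$ Suppose that the zeros of $\varphi$ are simple, and let $\zeta_1,\dots,\zeta_M$ be these zeros, with $M=\sum_\alpha m_\alpha$.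 **Field theory.** The local fields of a Hamiltonian field theory on $\mathbb R$ are given as a commutative complex differential algebra $\mathcal V$ (derivation $\partial_x$) with complex conjugation and a local Poisson bracket $\{f(x),g(y)\}=\sum_n c_n(y)\,\partial_y^n\delta(x-y)$ (finite sums; bilinear, compatible with $\partial_x$ and conjugation, skew-symmetric, and satisfying the Leibniz rule and the Jacobi identity), i.e. a Poisson vertex algebra. Charges $\int dx\,f$ are classes modulo total derivatives, and densities may also depend polynomially on $x$. Let $\mathcal P$ be a momentum, i.e. a charge in $\mathcal V/\partial_x\mathcal V$ with $\{\mathcal P,f\}=\partial_x f$ for every $f\in\mathcal V$. **Realisation.** Let $\mathcal J^\alpha_{[p]}$ ($\alpha\in\Sigma$, $0\le p<m_\alpha$) be $\mathfrak g$-valued local fields with $\tau(\mathcal J^\alpha_{[p]})=\mathcal J^{\bar\alpha}_{[p]}$ and $$\{\mathcal J^\alpha_{[p]}{}_{1}(x),\mathcal J^\beta_{[q]}{}_{2}(y)\}=\delta_{\alpha\beta}\bigl([C_{12},\mathcal J^\alpha_{[p+q]}{}_{1}(x)]\,\delta(x-y)-\ell^\alpha_{p+q}\,C_{12}\,\partial_x\delta(x-y)\bigr)$$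 if $p+q<m_\alpha$, and $0$ otherwise. Suppose that the realisation is suitable: $$\mathcal P=\sum_\alpha \frac12\sum_{q,r=0}^{m_\alpha-1}\eta^\alpha_{q+r}\int dx\,\kappa\bigl(\mathcal J^\alpha_{[q]},\mathcal J^\alpha_{[r]}\bigr),$$ where $(\eta^\alpha_p)_{0\le p\le 2m_\alpha-2}$ is the unique solution of $\sum_{p=0}^{m_\alpha-1-r}\eta^\alpha_{p+q}\ell^\alpha_{p+r}=\delta_{q,r}$ ($0\le q,r<m_\alpha$). **Dynamics.** Put $\Gamma(z,x)=\sum_\alpha\sum_{p=0}^{m_\alpha-1}\mathcal J^\alpha_{[p]}(x)/(z-z_\alpha)^{p+1}$ and $q_i=-\frac{1}{2\varphi'(\zeta_i)}\kappa\bigl(\Gamma(\zeta_i,x),\Gamma(\zeta_i,x)\bigr)$. Let $\epsilon_1,\dots,\epsilon_M\in\{1,-1\}$ (the relativistic case), and let the Hamiltonian be $\mathcal H=\sum_i\epsilon_i\int dx\,q_i$. For $t\in\mathbb R$ let $\mathcal B(t)=t\,\mathcal P+\int_{\mathbb R}dx\,x\sum_i\epsilon_i q_i(x)$ be the Lorentz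 boost. A local field $\mathcal F$ has *spin* $s$ if for all $t,\vartheta\in\mathbb R$ $$\vartheta\,\{\mathcal B(t),\mathcal F(x)\}=\vartheta t\,\partial_x\mathcal F(x)+\vartheta x\,\{\mathcal H,\mathcal F(x)\}+\vartheta s\,\mathcal F(x)$$ as an identity of fields depending on $x$; a $\mathfrak g$-valued field has spin $s$ if each of its components along the $I_a$ has spin $s$. **Proposition.** For every $i\in\{1,\dots,M\}$ the current $\Gamma(\zeta_i,x)$ has spin $\epsilon_i$. Moreover, for every integer $d\ge 0$ and every invariant homogeneous polynomial $\Phi_d$ of degree $d+1$ on $\mathfrak g$, the hierarchy charge $$\mathcal Q_i^d=-\frac{1}{(d+1)\varphi'(\zeta_i)}\int_{\mathbb R}dx\,\Phi_d\bigl(\Gamma(\zeta_i,x)\bigr)$$ has spin $\epsilon_i(d+1)$, in the sense that it is the integral of the local field $-\frac{1}{(d+1)\varphi'(\zeta_i)}\Phi_d(\Gamma(\zeta_i,x))$, which has spin $\epsilon_i(d+1)$. -/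

import Mathlib

open Polynomial TensorProduct

noncomputable section

namespace AGM

/-! ### Local Poisson algebras on the real line

The local fields of a Hamiltonian field theory on the line form a commutative complex algebra `V`
with the spatial derivative `∂` as a derivation. Charges are integrals of local fields, that is,
local fields modulo total derivatives. The Poisson bracket of two local fields is

`{f(x), g(y)} = ∑ₙ cₙ(y) ∂_yⁿ δ(x - y)`  (a finite sum, with local fields `cₙ`),

and it is encoded by the polynomial `{f_λ g} = ∑ₙ cₙ λⁿ ∈ V[λ]`. -/

section Brackets

variable {V : Type*} [CommRing V] [Algebra ℂ V]

/-- A derivation of `V`, applied to the coefficients of a polynomial over `V`. -/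
def coeffDer (D : Derivation ℂ V V) : V[X] →ₗ[ℂ] V[X] :=
  Polynomial.lsum fun n => ((monomial n : V →ₗ[V] V[X]).restrictScalars ℂ).comp (D : V →ₗ[ℂ] V)

/-- The operator `-λ - ∂` on `V[λ]`. -/
def negShift (D : Derivation ℂ V V) : V[X] →ₗ[ℂ] V[X] :=
  -(LinearMap.mulLeft ℂ (X : V[X])) - coeffDer D

/-- A polynomial `∑ₙ cₙ λⁿ` acting on a function `w` of `x` as `∑ₙ cₙ ∂_xⁿ w`. -/
def applySymbol (w : V[X]) : V[X] →ₗ[ℂ] V[X] :=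
  Polynomial.lsum fun n =>
    (LinearMap.mulRight ℂ ((derivative^[n]) w)).comp
      ((monomial 0 : V →ₗ[V] V[X]).restrictScalars ℂ)

lemma coeffDer_monomial (D : Derivation ℂ V V) (n : ℕ) (c : V) :
    coeffDer D (monomial n c) = monomial n (D c) := by
  simp [coeffDer, Polynomial.lsum_apply]

lemma applySymbol_monomial (w : V[X]) (n : ℕ) (c : V) :
    applySymbol w (monomial n c) = C c * (derivative^[n]) w := by
  simp [applySymbol, Polynomial.lsum_apply]

lemma applySymbol_X_mul (w p : V[X]) :
    applySymbol w (X * p) = applySymbol (derivative w) p := by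
  induction p using Polynomial.induction_on' with
  | add p q hp hq => simp [mul_add, hp, hq]
  | monomial n c =>
    rw [X_mul_monomial, applySymbol_monomial, applySymbol_monomial, Function.iterate_succ_apply]

lemma applySymbol_C_mul (k : ℕ) (w p : V[X]) :
    applySymbol ((k : V[X]) * w) p = (k : V[X]) * applySymbol w p := by
  induction p using Polynomial.induction_on' with
  | add p q hp hq => simp [mul_add, hp, hq]
  | monomial n c =>
    rw [applySymbol_monomial, applySymbol_monomial, iterate_derivative_natCast_mul]
    ring

end Brackets

/-- The algebra of local fields of a Hamiltonian field theory on the line: a differential algebra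
with a local Poisson bracket (a Poisson vertex algebra) and a compatible complex conjugation
`star`. The axioms are those of a Poisson bracket of local fields, written for
`br f g = {f_λ g}`: compatibility with the derivative in either argument, skew-symmetry, the
Leibniz rule, and the Jacobi identity (the coefficient of `λᵐ μᵏ` in
`{f_λ {g_μ h}} - {g_μ {f_λ h}} = {{f_λ g}_{λ+μ} h}`). -/
class LocalPoissonAlgebra (V : Type*) [CommRing V] [Algebra ℂ V] [StarRing V] where
  /-- the spatial derivative `∂_x` -/
  der : Derivation ℂ V V
  /-- the bracket `{f_λ g}`, a polynomial in `λ = X` -/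
  br : V →ₗ[ℂ] V →ₗ[ℂ] V[X]
  br_der_left : ∀ f g : V, br (der f) g = -(X * br f g)
  br_der_right : ∀ f g : V, br f (der g) = X * br f g + coeffDer der (br f g)
  skew : ∀ f g : V,
    br g f = -((br f g).sum fun n c => ((negShift der)^[n]) (C c))
  leibniz : ∀ f g h : V, br f (g * h) = br f g * C h + C g * br f h
  jacobi : ∀ (f g h : V) (m k : ℕ),
    (br f ((br g h).coeff k)).coeff m - (br g ((br f h).coeff m)).coeff k
      = ∑ l ∈ Finset.range (m + 1),
          ((m - l + k).choose k : V) * (br ((br f g).coeff l) h).coeff (m - l + k)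
  der_star : ∀ f : V, der (star f) = star (der f)
  br_star : ∀ (f g : V) (m : ℕ), (br (star f) (star g)).coeff m = star ((br f g).coeff m)

open LocalPoissonAlgebra

section Charges

variable (V : Type*) [CommRing V] [Algebra ℂ V] [StarRing V] [LocalPoissonAlgebra V]

/-- Charges `∫ dx f(x)`: local fields modulo total derivatives. -/
abbrev Charge : Type _ := V ⧸ LinearMap.range ((der : Derivation ℂ V V) : V →ₗ[ℂ] V)

/-- The total spatial derivative on local fields with explicit polynomial dependence on the
coordinate `x`: elements of `V[x]`, with `x = X`. -/
def totalDer : V[X] →ₗ[ℂ] V[X] :=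
  coeffDer der + (derivative : V[X] →ₗ[V] V[X]).restrictScalars ℂ

/-- Charges `∫ dx h(x)` whose density `h ∈ V[x]` may depend explicitly on `x`. -/
abbrev XCharge : Type _ := V[X] ⧸ LinearMap.range (totalDer V)

variable {V}

/-- The charge `∫ dx f(x)`. -/
def integral : V →ₗ[ℂ] Charge V := Submodule.mkQ _

/-- The charge `∫ dx h(x)`, for a density with explicit dependence on `x`. -/
def xIntegral : V[X] →ₗ[ℂ] XCharge V := Submodule.mkQ _

/-- The bracket `h ↦ {∫ dy h(y), f(x)}` at the level of densities: for a density `yᵏ g(y)`, and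
`{g(y), f(x)} = ∑ₙ cₙ(x) ∂_xⁿ δ(y - x)`, it is `∑ₙ cₙ(x) ∂_xⁿ xᵏ`. -/
def xFlowDensity (f : V) : V[X] →ₗ[ℂ] V[X] :=
  Polynomial.lsum fun k =>
    (applySymbol ((X : V[X]) ^ k)).comp ((br : V →ₗ[ℂ] V →ₗ[ℂ] V[X]).flip f)

lemma xFlowDensity_monomial (f : V) (k : ℕ) (c : V) :
    xFlowDensity f (monomial k c) = applySymbol ((X : V[X]) ^ k) (br c f) := by
  simp [xFlowDensity, Polynomial.lsum_apply]

/-- A total derivative has vanishing bracket with every local field. -/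
lemma xFlowDensity_totalDer (f : V) (h : V[X]) : xFlowDensity f (totalDer V h) = 0 := by
  induction h using Polynomial.induction_on' with
  | add p q hp hq => simp [hp, hq]
  | monomial k c =>
    have h1 : totalDer V (monomial k c)
        = monomial k (der c) + monomial (k - 1) (c * (k : V)) := by
      simp [totalDer, coeffDer_monomial, derivative_monomial]
    have h2 : c * (k : V) = (k : ℂ) • c := by
      rw [Nat.cast_smul_eq_nsmul, nsmul_eq_mul, mul_comm]
    rw [h1, map_add, xFlowDensity_monomial, xFlowDensity_monomial, br_der_left, map_neg,
      applySymbol_X_mul, h2, map_smul, LinearMap.smul_apply, map_smul, derivative_X_pow]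
    have h3 : (C (k : V) : V[X]) = (k : V[X]) := by simp
    rw [h3, applySymbol_C_mul, Nat.cast_smul_eq_nsmul, nsmul_eq_mul]
    ring

/-- The Hamiltonian flow `{B, f(x)} ∈ V[x]` of a charge `B` with explicit dependence on `x`. -/
def XCharge.flow (B : XCharge V) (f : V) : V[X] :=
  (LinearMap.range (totalDer V)).liftQ (xFlowDensity f)
    (by rintro _ ⟨h, rfl⟩; exact xFlowDensity_totalDer f h) B

/-- The Hamiltonian flow `{Q, f(x)}` of a charge `Q = ∫ dy g(y)`: the integral over `y` of
`{g(y), f(x)}`. -/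
def Charge.flow (Q : Charge V) (f : V) : V :=
  (LinearMap.range ((der : Derivation ℂ V V) : V →ₗ[ℂ] V)).liftQ
    (((Polynomial.lcoeff V 0).restrictScalars ℂ).comp ((br : V →ₗ[ℂ] V →ₗ[ℂ] V[X]).flip f))
    (by
      rintro _ ⟨h, rfl⟩
      simp [br_der_left]) Q

/-- A charge, seen as a charge whose density happens not to depend explicitly on `x`. -/
def Charge.toX : Charge V →ₗ[ℂ] XCharge V :=
  (LinearMap.range ((der : Derivation ℂ V V) : V →ₗ[ℂ] V)).liftQ
    (xIntegral.comp ((monomial 0 : V →ₗ[V] V[X]).restrictScalars ℂ))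
    (by
      rintro _ ⟨h, rfl⟩
      refine (Submodule.Quotient.mk_eq_zero _).2 ⟨monomial 0 h, ?_⟩
      have h1 := coeffDer_monomial (der : Derivation ℂ V V) 0 h
      simp only [totalDer, LinearMap.add_apply, h1]
      simp)

/-- `P` is a momentum: its Hamiltonian flow is the spatial derivative on all local fields. -/
def IsMomentum (P : Charge V) : Prop := ∀ f : V, P.flow f = der f

/-- The variation `δF(x,t) = ϑ {B(t), F(x,t)}` of a local field under the infinitesimal
transformation of parameter `ϑ` generated by a time-dependent charge `B`. -/
def variation (B : ℝ → XCharge V) (ϑ t : ℝ) (F : V) : V[X] := (ϑ : ℂ) • (B t).flow F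

/-- The local field `F` has spin `s` for the boost `B` and the Hamiltonian `H`. With
`δx = ϑ t`, `δt = ϑ x`, `∂_t = {H, ·}`, its variation is `δx ∂_x F + δt ∂_t F + ϑ s F`,
as an identity of fields in `x` for all `t` and all `ϑ`. -/
def HasSpin (B : ℝ → XCharge V) (H : Charge V) (s : ℝ) (F : V) : Prop :=
  ∀ ϑ t : ℝ, variation B ϑ t F
    = ((ϑ * t : ℝ) : ℂ) • C (der F) + ((ϑ : ℂ) • (X : V[X])) * C (H.flow F)
      + ((ϑ * s : ℝ) : ℂ) • C F

end Charges

/-! ### The Lie algebra -/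

section Lie

variable (𝔤 : Type*) [LieRing 𝔤] [LieAlgebra ℂ 𝔤]

/-- The opposite of the Killing form. -/
def kappa : LinearMap.BilinForm ℂ 𝔤 := -killingForm ℂ 𝔤

/-- A real form of `𝔤`, as the fixed points of an antilinear involutive automorphism `τ`, with a
basis `(I_a)` of `𝔤` consisting of elements of the real form. -/
structure RealBasis (n : ℕ) where
  τ : 𝔤 →ₛₗ[starRingEnd ℂ] 𝔤
  τ_lie : ∀ Y Z : 𝔤, τ ⁅Y, Z⁆ = ⁅τ Y, τ Z⁆
  τ_τ : ∀ Y : 𝔤, τ (τ Y) = Y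
  I : Module.Basis (Fin n) ℂ 𝔤
  τ_I : ∀ a, τ (I a) = I a

variable [FiniteDimensional ℂ 𝔤] [LieAlgebra.IsSimple ℂ 𝔤]

lemma kappa_nondegenerate : (kappa 𝔤).Nondegenerate := by
  have h := LieAlgebra.IsKilling.killingForm_nondegenerate ℂ 𝔤
  refine ⟨fun x hx => h.1 x fun y => ?_, fun y hy => h.2 y fun x => ?_⟩
  · simpa [kappa] using hx y
  · simpa [kappa] using hy x

namespace RealBasis

variable {𝔤} {n : ℕ} (E : RealBasis 𝔤 n)

/-- The dual basis `(I^a)` with respect to `κ`. -/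
def dual : Module.Basis (Fin n) ℂ 𝔤 := (kappa 𝔤).dualBasis (kappa_nondegenerate 𝔤) E.I

/-- The split Casimir `C₁₂ = ∑ I_a ⊗ I^a`. -/
def casimir : 𝔤 ⊗[ℂ] 𝔤 := ∑ a, E.I a ⊗ₜ E.dual a

/-- The commutator `[C₁₂, Y₁] = ∑ [I_a, Y] ⊗ I^a`. -/
def casimirComm (Y : 𝔤) : 𝔤 ⊗[ℂ] 𝔤 := ∑ a, ⁅E.I a, Y⁆ ⊗ₜ E.dual a

/-- The components of an element of `𝔤 ⊗ 𝔤` along `I_a ⊗ I_b`. -/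
def comp₂ (u : 𝔤 ⊗[ℂ] 𝔤) (a b : Fin n) : ℂ := (E.I.tensorProduct E.I).repr u (a, b)

/-- A polynomial function on `𝔤`, written in the coordinates of the basis `(I_a)`, is invariant:
its derivative at `Y` in the direction `[Z, Y]` vanishes, for all `Y` and `Z`. -/
def IsInvariant (Φ : MvPolynomial (Fin n) ℂ) : Prop :=
  ∀ Y Z : 𝔤, ∑ a, E.I.repr ⁅Z, Y⁆ a *
    MvPolynomial.eval (fun b => E.I.repr Y b) (MvPolynomial.pderiv a Φ) = 0

/-- `κ(F, G)` for two `𝔤`-valued fields `F = ∑ F^a I_a` and `G = ∑ G^a I_a`. A `𝔤`-valued field is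
given throughout by its components along the basis `(I_a)`. -/
def kappaField {V : Type*} [CommRing V] [Algebra ℂ V] (F G : Fin n → V) : V :=
  ∑ a, ∑ b, kappa 𝔤 (E.I a) (E.I b) • (F a * G b)

end RealBasis

end Lie

/-! ### Parameters of a local affine Gaudin model -/

/-- The numbers `η_p` attached to levels `ℓ_0, …, ℓ_{m-1}` with `ℓ_{m-1} ≠ 0`: they vanish for
`p < m - 1`, and `η_{m-1}, η_m, …` are the coefficients of the inverse of the power series
`ℓ_{m-1} + ℓ_{m-2} u + ⋯ + ℓ_0 u^{m-1}`. -/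
def ssNumber (m : ℕ) (l : ℕ → ℂ) (p : ℕ) : ℂ :=
  if p + 1 < m then 0
  else PowerSeries.coeff (p + 1 - m)
    (PowerSeries.mk fun k => if k < m then l (m - 1 - k) else 0)⁻¹

/-- The numbers `η_p` solve the linear system that defines them. -/
theorem ssNumber_spec (m : ℕ) (l : ℕ → ℂ) (hl : l (m - 1) ≠ 0) (q r : ℕ) (hq : q < m)
    (hr : r < m) :
    ∑ p ∈ Finset.range (m - r), ssNumber m l (p + q) * l (p + r) = if q = r then 1 else 0 := by
  set f : PowerSeries ℂ := PowerSeries.mk fun k => if k < m then l (m - 1 - k) else 0 with hf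
  have hm : 0 < m := by omega
  have hf0 : PowerSeries.constantCoeff f ≠ 0 := by
    rw [← PowerSeries.coeff_zero_eq_constantCoeff_apply]
    simpa [hf, hm] using hl
  rcases lt_or_ge q r with hqr | hqr
  · rw [if_neg hqr.ne]
    refine Finset.sum_eq_zero fun p hp => ?_
    have : p + q + 1 < m := by have := Finset.mem_range.1 hp; omega
    simp [ssNumber, this]
  · have key : PowerSeries.coeff (q - r) (f⁻¹ * f) = if q = r then 1 else 0 := by
      rw [PowerSeries.inv_mul_cancel f hf0, PowerSeries.coeff_one]
      exact if_congr (by omega) rfl rfl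
    rw [← key, PowerSeries.coeff_mul, Finset.Nat.sum_antidiagonal_eq_sum_range_succ
      (fun i j => PowerSeries.coeff i f⁻¹ * PowerSeries.coeff j f)]
    symm
    refine Finset.sum_of_injOn (fun k => k + (m - 1 - q)) ?_ ?_ ?_ ?_
    · intro a _ b _ h
      simpa using h
    · intro k hk
      have hk := Finset.mem_range.1 (Finset.mem_coe.1 hk)
      refine Finset.mem_coe.2 (Finset.mem_range.2 ?_)
      show k + (m - 1 - q) < m - r
      omega
    · intro p hp hp'
      have hp := Finset.mem_range.1 hp
      have : p + q + 1 < m := by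
        by_contra hcon
        refine hp' ⟨p + q + 1 - m, ?_, ?_⟩
        · refine Finset.mem_coe.2 (Finset.mem_range.2 ?_)
          omega
        · show p + q + 1 - m + (m - 1 - q) = p
          omega
      simp [ssNumber, this]
    · intro k hk
      have hk := Finset.mem_range.1 hk
      have e1 : ¬ (k + (m - 1 - q) + q + 1 < m) := by omega
      have e2 : k + (m - 1 - q) + q + 1 - m = k := by omega
      have e3 : q - r - k < m := by omega
      have e4 : m - 1 - (q - r - k) = k + (m - 1 - q) + r := by omega
      show _ = ssNumber m l (k + (m - 1 - q) + q) * l (k + (m - 1 - q) + r)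
      rw [ssNumber, if_neg e1, e2, ← hf]
      congr 1
      rw [hf, PowerSeries.coeff_mk, if_pos e3, e4]

/-- The linear system has only one solution `η_0, …, η_{2m-2}`. -/
theorem ssNumber_unique (m : ℕ) (l : ℕ → ℂ) (hl : l (m - 1) ≠ 0) (η : ℕ → ℂ)
    (hη : ∀ q r, q < m → r < m →
      ∑ p ∈ Finset.range (m - r), η (p + q) * l (p + r) = if q = r then 1 else 0) :
    ∀ k, k < 2 * m - 1 → η k = ssNumber m l k := by
  intro k
  induction k using Nat.strong_induction_on with
  | _ k ih =>
    intro hk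
    obtain ⟨q, r, hq, hr, hqk⟩ : ∃ q r, q < m ∧ r < m ∧ m - 1 - r + q = k := by
      rcases lt_or_ge k m with h | h
      · exact ⟨k, m - 1, h, by omega, by omega⟩
      · exact ⟨m - 1, 2 * m - 2 - k, by omega, by omega, by omega⟩
    have e : m - r = (m - 1 - r) + 1 := by omega
    have h1 := hη q r hq hr
    have h2 := ssNumber_spec m l hl q r hq hr
    rw [e, Finset.sum_range_succ] at h1 h2
    have h3 : ∑ p ∈ Finset.range (m - 1 - r), η (p + q) * l (p + r)
        = ∑ p ∈ Finset.range (m - 1 - r), ssNumber m l (p + q) * l (p + r) := by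
      refine Finset.sum_congr rfl fun p hp => ?_
      have hp := Finset.mem_range.1 hp
      rw [ih (p + q) (by omega) (by omega)]
    rw [h3, ← h2, add_right_inj, hqk, show m - 1 - r + r = m - 1 by omega] at h1
    exact mul_right_cancel₀ hl h1

/-- Takiff datum, positions of the sites and constant term of the twist function. The involution
`bar` is the conjugation of sites: its fixed points are the real sites, and its other orbits are
the pairs of a complex site and its conjugate. The levels of a site `α` are `lev α p` with
`p < m α`; other values of `lev` are never used. -/
structure Params (S : Type*) [Fintype S] where
  bar : S → S
  bar_bar : ∀ α, bar (bar α) = α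
  m : S → ℕ
  m_pos : ∀ α, 0 < m α
  m_bar : ∀ α, m (bar α) = m α
  lev : S → ℕ → ℂ
  lev_bar : ∀ α p, p < m α → lev (bar α) p = star (lev α p)
  lev_top : ∀ α, lev α (m α - 1) ≠ 0
  pos : S → ℂ
  pos_bar : ∀ α, pos (bar α) = star (pos α)
  pos_injective : Function.Injective pos
  lInf : ℝ
  lInf_ne_zero : lInf ≠ 0

namespace Params

variable {S : Type*} [Fintype S] (D : Params S)

/-- The total multiplicity `M`, the number of zeros of the twist function. -/
def M : ℕ := ∑ α, D.m α

/-- The twist function `φ(z)`, for `z` not a position of a site. -/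
def twist (z : ℂ) : ℂ :=
  ∑ α, ∑ p ∈ Finset.range (D.m α), D.lev α p / (z - D.pos α) ^ (p + 1) - (D.lInf : ℂ)

/-- The `ζ_i` enumerate, without repetition, the zeros of the twist function, and these zeros are
all simple. -/
structure IsZeros (ζ : Fin D.M → ℂ) : Prop where
  injective : Function.Injective ζ
  zero_iff : ∀ z : ℂ, ((∀ α, z ≠ D.pos α) ∧ D.twist z = 0) ↔ ∃ i, ζ i = z
  simple : ∀ i, deriv D.twist (ζ i) ≠ 0

end Params

/-! ### Realisations -/

section Realisation

variable {𝔤 : Type*} [LieRing 𝔤] [LieAlgebra ℂ 𝔤] [FiniteDimensional ℂ 𝔤]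
  [LieAlgebra.IsSimple ℂ 𝔤] {n : ℕ} {S : Type*} [Fintype S]

/-- A realisation in `V` of the Takiff algebra: `𝔤`-valued fields `J α p` (for `p < m α`; other
values are never used) that satisfy the reality conditions and, for sites `α, β`,

`{J^α_p ₁(x), J^β_q ₂(y)} = δ_{αβ} ([C₁₂, J^α_{p+q} ₁(x)] δ(x-y) - ℓ^α_{p+q} C₁₂ ∂_x δ(x-y))`

if `p + q < m α`, and `0` otherwise. Note that `-∂_x δ(x-y) = ∂_y δ(x-y)`, which is encoded by
`λ = X`. The reality condition `τ(J^α_p) = J^{bar α}_p` is read on components along the `I_a`,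
which are fixed by `τ`. -/
structure Realisation (E : RealBasis 𝔤 n) (D : Params S) (V : Type*) [CommRing V] [Algebra ℂ V]
    [StarRing V] [LocalPoissonAlgebra V] where
  J : S → ℕ → Fin n → V
  star_J : ∀ α p a, p < D.m α → star (J α p a) = J (D.bar α) p a
  bracket_same : ∀ α p q a b, p + q < D.m α →
    br (J α p a) (J α q b)
      = C (∑ c, E.comp₂ (E.casimirComm (E.I c)) a b • J α (p + q) c)
        + (D.lev α (p + q) * E.comp₂ E.casimir a b) • (X : V[X])
  bracket_zero : ∀ α β p q a b, p < D.m α → q < D.m β → (α ≠ β ∨ D.m α ≤ p + q) →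
    br (J α p a) (J β q b) = 0

namespace Realisation

variable {E : RealBasis 𝔤 n} {D : Params S} {V : Type*} [CommRing V] [Algebra ℂ V]
  [StarRing V] [LocalPoissonAlgebra V] (R : Realisation E D V)

/-- The Gaudin Lax matrix `Γ(z)`, for `z` not a position of a site. -/
def Γ (z : ℂ) (a : Fin n) : V :=
  ∑ α, ∑ p ∈ Finset.range (D.m α), ((z - D.pos α) ^ (p + 1))⁻¹ • R.J α p a

/-- The density of the generalised Segal-Sugawara integral `D^α_p`. -/
def ssDensity (α : S) (p : ℕ) : V :=
  (1 / 2 : ℂ) • ∑ q ∈ Finset.range (D.m α), ∑ r ∈ Finset.range (D.m α),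
    if p ≤ q + r then
      ssNumber (D.m α) (D.lev α) (q + r - p) • E.kappaField (R.J α q) (R.J α r)
    else 0

/-- The image `∑_α D^α_0` of the momentum of the Takiff algebra. -/
def takiffMomentum : Charge V := ∑ α, integral (R.ssDensity α 0)

/-- The realisation is suitable: the momentum of the Takiff algebra is sent to the momentum
`P` of the algebra of observables. -/
def IsSuitable (P : Charge V) : Prop := R.takiffMomentum = P

/-- The density `q_i = -κ(Γ(ζ_i), Γ(ζ_i)) / (2 φ'(ζ_i))` of the quadratic charge `Q_i`. -/
def q (ζ : Fin D.M → ℂ) (i : Fin D.M) : V :=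
  (-1 / (2 * deriv D.twist (ζ i))) • E.kappaField (R.Γ (ζ i)) (R.Γ (ζ i))

/-- The quadratic charge `Q_i`. -/
def Q (ζ : Fin D.M → ℂ) (i : Fin D.M) : Charge V := integral (R.q ζ i)

/-- The Hamiltonian `H = ∑ ε_i Q_i`. -/
def hamiltonian (ζ : Fin D.M → ℂ) (ε : Fin D.M → ℝ) : Charge V := ∑ i, (ε i : ℂ) • R.Q ζ i

/-- The energy density `T⁰₀ = ∑ ε_i q_i`. -/
def energyDensity (ζ : Fin D.M → ℂ) (ε : Fin D.M → ℝ) : V := ∑ i, (ε i : ℂ) • R.q ζ i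

/-- The Lorentz boost `B(t) = t P + ∫ dx x T⁰₀(x)`. -/
def boost (P : Charge V) (ζ : Fin D.M → ℂ) (ε : Fin D.M → ℝ) (t : ℝ) : XCharge V :=
  (t : ℂ) • P.toX + xIntegral (X * C (R.energyDensity ζ ε))

/-- The density `-Φ(Γ(ζ_i)) / ((d+1) φ'(ζ_i))` of a charge of the hierarchy. -/
def hierarchyDensity (ζ : Fin D.M → ℂ) (i : Fin D.M) (d : ℕ) (Φ : MvPolynomial (Fin n) ℂ) : V :=
  (-1 / ((d + 1 : ℂ) * deriv D.twist (ζ i))) • MvPolynomial.aeval (R.Γ (ζ i)) Φ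

/-- The charge `Q_i^d = -1/((d+1) φ'(ζ_i)) ∫ dx Φ(Γ(ζ_i, x))` of the hierarchy. -/
def hierarchyCharge (ζ : Fin D.M → ℂ) (i : Fin D.M) (d : ℕ) (Φ : MvPolynomial (Fin n) ℂ) :
    Charge V :=
  (-1 / ((d + 1 : ℂ) * deriv D.twist (ζ i))) • integral (MvPolynomial.aeval (R.Γ (ζ i)) Φ)

end Realisation

end Realisation

end AGM

end

/-! With `T = ∑ ε_i q_i` and `{T(y), F(x)} = ∑ c_n(x) ∂_xⁿ δ(y - x)`, integrating against `y` gives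
`x c_0 + c_1`. Here `c_0 = {H, F}`, and the term `t P` of the boost contributes `t ∂F`, so `F` has
spin `s` as soon as `c_1 = s F` (`hasSpin_of_coeff_one`).

Only the level terms of the current brackets reach first order. The first-order part of `{Γ(z),
Γ(w)}` is therefore the constant `C₁₂` times the divided difference `(φ(z) - φ(w)) / (w - z)`
(`coeff_one_br_Γ`). At zeros of `φ` this is `0` for distinct points and `-φ'(ζ_i)` on the diagonal.
Since `C₁₂` inverts `κ`, the normalisation of `q_j` makes its first-order action on `Γ(ζ_i)` equal
to `δ_ij Γ(ζ_i)` (`coeff_one_br_q_Γ`), and `T` acts with eigenvalue `ε_i`.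

Finally `F ↦ c_1` is a derivation by the Leibniz rule, so Euler's identity multiplies the eigenvalue
by `d + 1` on homogeneous polynomials of that degree in the components of `Γ(ζ_i)`. -/

noncomputable section

namespace AGM

open LocalPoissonAlgebra

/-! ### Spin and the first-order term of the bracket with the energy density -/

section Spin

variable {V : Type*} [CommRing V] [Algebra ℂ V] [StarRing V] [LocalPoissonAlgebra V]

/-- For a bracket of differential order at most one, the first-order coefficient is symmetric. -/
lemma coeff_one_br_swap {f g : V} (h : (br f g).natDegree ≤ 1) :
    (br g f).coeff 1 = (br f g).coeff 1 := by
  -- Skew-symmetry reads `{g_λ f} = -(c_0 + (-λ - ∂) c_1)`: the two signs in front of `λ c_1`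
  -- cancel, and `∂ c_1` only enters at order zero.
  rw [skew f g, Polynomial.sum_over_range' _ _ 2 (by omega)]
  · have h1 := coeffDer_monomial (der : Derivation ℂ V V) 0 ((br f g).coeff 1)
    rw [monomial_zero_left, monomial_zero_left] at h1
    simp [Finset.sum_range_succ, negShift, h1, coeff_C]
  · intro n
    rw [C_0, ← Module.End.coe_pow, map_zero]

/-- The first-order coefficient of the bracket with a fixed field, as a derivation. -/
def brCoeff (T : V) (m : ℕ) : Derivation ℂ V V :=
  Derivation.mk' (((Polynomial.lcoeff V m).restrictScalars ℂ).comp (br T)) fun g h => by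
    simp [leibniz, mul_comm, add_comm]

lemma brCoeff_apply (T f : V) (m : ℕ) : brCoeff T m f = (br T f).coeff m := rfl

lemma Charge.flow_integral (f g : V) : (integral g : Charge V).flow f = (br g f).coeff 0 := rfl

lemma XCharge.flow_add (B B' : XCharge V) (f : V) : (B + B').flow f = B.flow f + B'.flow f :=
  map_add _ B B'

lemma XCharge.flow_smul (c : ℂ) (B : XCharge V) (f : V) : (c • B).flow f = c • B.flow f :=
  map_smul _ c B

/-- The weight is `x⁰ = 1`, whose derivatives vanish, so only `c_0` survives. -/
lemma XCharge.flow_toX (Q : Charge V) (f : V) :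
    (Charge.toX Q).flow f = C (Q.flow f) := by
  obtain ⟨g, rfl⟩ := Submodule.Quotient.mk_surjective _ Q
  change xFlowDensity f (monomial 0 g) = C ((br g f).coeff 0)
  rw [xFlowDensity_monomial, pow_zero]
  generalize br g f = p
  induction p using Polynomial.induction_on' with
  | add p q hp hq => simp [hp, hq]
  | monomial n c =>
    rw [applySymbol_monomial]
    cases n <;> simp [coeff_monomial, Function.iterate_succ_apply]

/-- The weight `x` has derivatives `1, 0, 0, …`, so the terms of order at least two drop out and
`c_1` appears without a factor of `x`. -/
lemma XCharge.flow_xIntegral_X_mul (T f : V) :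
    (xIntegral (X * C T) : XCharge V).flow f = X * C ((br T f).coeff 0) + C ((br T f).coeff 1) := by
  change xFlowDensity f (X * C T) = _
  rw [← monomial_zero_left, X_mul_monomial, xFlowDensity_monomial, pow_one]
  generalize br T f = p
  induction p using Polynomial.induction_on' with
  | add p q hp hq => rw [map_add, hp, hq, coeff_add, coeff_add, C_add, C_add]; ring
  | monomial n c =>
    rw [applySymbol_monomial]
    match n with
    | 0 => simp [mul_comm X]
    | 1 => simp [coeff_monomial]
    | n + 2 => simp [coeff_monomial, Function.iterate_succ_apply]

/-- For the boost `t P + ∫ dx x T(x)` and the Hamiltonian `∫ dx T(x)`, having spin `s` amounts to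
an eigenvalue equation for the first-order coefficient of the bracket with `T`. -/
lemma hasSpin_of_coeff_one {P : Charge V} (hP : IsMomentum P) (T : V) (s : ℝ) (F : V)
    (h : (br T F).coeff 1 = (s : ℂ) • F) :
    HasSpin (fun t => (t : ℂ) • P.toX + xIntegral (X * C T)) (integral T) s F := by
  intro ϑ t
  rw [variation, XCharge.flow_add, XCharge.flow_smul, XCharge.flow_toX, hP F,
    XCharge.flow_xIntegral_X_mul, h, Charge.flow_integral, ← smul_C]
  push_cast
  simp only [smul_add, smul_smul, smul_mul_assoc, add_assoc]

end Spin

/-- A derivation that scales the variables by `s` scales a homogeneous polynomial of degree `N`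
in them by `N s`. -/
lemma derivation_aeval_of_isHomogeneous {V σ : Type*} [CommRing V] [Algebra ℂ V]
    (δ : Derivation ℂ V V) (v : σ → V) (s : ℂ) (hδ : ∀ a, δ (v a) = s • v a)
    {Φ : MvPolynomial σ ℂ} {N : ℕ} (hΦ : Φ.IsHomogeneous N) :
    δ (MvPolynomial.aeval v Φ) = (s * N) • MvPolynomial.aeval v Φ := by
  -- Euler's identity for a single monomial: the eigenvalues of the factors add up under the product
  -- rule, as the degree does.
  have key : ∀ u : σ →₀ ℕ, δ (u.prod fun a k => v a ^ k) =
      (s * (u.degree : ℕ)) • u.prod fun a k => v a ^ k := by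
    intro u
    induction u using Finsupp.induction_linear with
    | zero => simp
    | add f g hf hg =>
      rw [Finsupp.prod_add_index' (by simp) (by intros; rw [pow_add]), δ.leibniz, hf, hg, map_add]
      simp only [smul_eq_mul, Algebra.smul_def, map_mul, map_natCast]
      push_cast
      ring
    | single a k =>
      rw [Finsupp.prod_single_index (by simp), δ.leibniz_pow, hδ, Finsupp.degree_single]
      -- The power rule involves the truncated exponent `k - 1`; at `k = 0` its prefactor vanishes.
      cases k with
      | zero => simp
      | succ k =>
        simp only [smul_eq_mul, Algebra.smul_def (R := ℂ), map_mul, map_natCast, nsmul_eq_mul,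
          Nat.add_sub_cancel]
        ring
  rw [MvPolynomial.aeval_def, MvPolynomial.eval₂_eq, map_sum, Finset.smul_sum]
  refine Finset.sum_congr rfl fun u hu => ?_
  have h1 := key u
  rw [show u.degree = N by
    rw [Finsupp.degree_eq_weight_one]; exact hΦ (MvPolynomial.mem_support_iff.1 hu)] at h1
  rw [← Algebra.smul_def, δ.map_smul]
  exact (congrArg _ h1).trans (smul_comm _ _ _)

/-! ### The Casimir element -/

section Casimir

variable {𝔤 : Type*} [LieRing 𝔤] [LieAlgebra ℂ 𝔤] [FiniteDimensional ℂ 𝔤]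
  [LieAlgebra.IsSimple ℂ 𝔤] {n : ℕ} (E : RealBasis 𝔤 n)

omit [FiniteDimensional ℂ 𝔤] [LieAlgebra.IsSimple ℂ 𝔤] in
lemma kappa_comm (Y Z : 𝔤) : kappa 𝔤 Y Z = kappa 𝔤 Z Y := by
  simp [kappa, killingForm, LieModule.traceForm_comm ℂ 𝔤 𝔤 Y Z]

namespace RealBasis

lemma comp₂_casimir (a b : Fin n) : E.comp₂ E.casimir a b = E.I.repr (E.dual a) b := by
  simp [comp₂, casimir, Module.Basis.tensorProduct_repr_tmul_apply, Finsupp.single_apply]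

/-- The components of the Casimir element are inverse to the matrix of `κ`. -/
lemma sum_comp₂_casimir_mul_kappa (a c : Fin n) :
    ∑ b, E.comp₂ E.casimir a b * kappa 𝔤 (E.I b) (E.I c) = if a = c then 1 else 0 := by
  have h := LinearMap.BilinForm.apply_dualBasis_left (B := kappa 𝔤) (kappa_nondegenerate 𝔤) E.I a c
  change kappa 𝔤 (E.dual a) (E.I c) = _ at h
  rw [← E.I.sum_repr (E.dual a)] at h
  simp only [map_sum, map_smul, LinearMap.sum_apply, LinearMap.smul_apply, smul_eq_mul] at h
  simp only [comp₂_casimir, h, eq_comm]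

/-- Contracting with the Casimir element undoes the polarisation of `κ(F, F)`. -/
lemma sum_kappa_casimir {V : Type*} [CommRing V] [Algebra ℂ V] (F : Fin n → V) (a : Fin n) :
    ∑ b, ∑ c, kappa 𝔤 (E.I b) (E.I c) •
      (E.comp₂ E.casimir a b • F c + E.comp₂ E.casimir a c • F b) = (2 : ℂ) • F a := by
  have h1 : ∑ b, ∑ c, (E.comp₂ E.casimir a b * kappa 𝔤 (E.I b) (E.I c)) • F c = F a := by
    rw [Finset.sum_comm]
    simp [← Finset.sum_smul, sum_comp₂_casimir_mul_kappa]
  have h2 : ∑ b, ∑ c, (E.comp₂ E.casimir a c * kappa 𝔤 (E.I b) (E.I c)) • F b = F a := by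
    have h : ∀ b, ∑ c, E.comp₂ E.casimir a c * kappa 𝔤 (E.I b) (E.I c)
        = if a = b then 1 else 0 := fun b => by
      rw [← E.sum_comp₂_casimir_mul_kappa a b]
      exact Finset.sum_congr rfl fun c _ => by rw [kappa_comm]
    simp [← Finset.sum_smul, h]
  calc _ = ∑ b, ∑ c, (E.comp₂ E.casimir a b * kappa 𝔤 (E.I b) (E.I c)) • F c +
        ∑ b, ∑ c, (E.comp₂ E.casimir a c * kappa 𝔤 (E.I b) (E.I c)) • F b := by
        simp only [smul_add, smul_smul, Finset.sum_add_distrib, mul_comm]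
    _ = _ := by rw [h1, h2, two_smul]

end RealBasis

end Casimir

/-! ### The twist function -/

namespace Params

variable {S : Type*} [Fintype S] (D : Params S)

/-- The divided difference `(φ(z) - φ(w)) / (w - z)` of the twist function, as an explicit sum. -/
def dividedTwist (z w : ℂ) : ℂ :=
  ∑ α, ∑ p ∈ Finset.range (D.m α), ∑ q ∈ Finset.range (D.m α), if p + q < D.m α then
    ((z - D.pos α) ^ (p + 1))⁻¹ * ((w - D.pos α) ^ (q + 1))⁻¹ * D.lev α (p + q) else 0

/-- Regrouping by `k = p + q` isolates each level and exposes the geometric sums used off and on the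
diagonal. -/
lemma dividedTwist_eq (z w : ℂ) : D.dividedTwist z w =
    ∑ α, ∑ k ∈ Finset.range (D.m α), D.lev α k * ((z - D.pos α)⁻¹ * (w - D.pos α)⁻¹ *
      ∑ j ∈ Finset.range (k + 1), (z - D.pos α)⁻¹ ^ j * (w - D.pos α)⁻¹ ^ (k - j)) := by
  refine Finset.sum_congr rfl fun α _ => ?_
  have h := Finset.sum_range_diag_flip (D.m α) fun p q =>
    ((z - D.pos α) ^ (p + 1))⁻¹ * ((w - D.pos α) ^ (q + 1))⁻¹ * D.lev α (p + q)
  have h1 : ∀ p ∈ Finset.range (D.m α), (∑ q ∈ Finset.range (D.m α), if p + q < D.m α then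
      ((z - D.pos α) ^ (p + 1))⁻¹ * ((w - D.pos α) ^ (q + 1))⁻¹ * D.lev α (p + q) else 0) =
      ∑ q ∈ Finset.range (D.m α - p),
        ((z - D.pos α) ^ (p + 1))⁻¹ * ((w - D.pos α) ^ (q + 1))⁻¹ * D.lev α (p + q) := by
    intro p _
    rw [← Finset.sum_filter]
    refine Finset.sum_congr ?_ fun _ _ => rfl
    ext q
    simp only [Finset.mem_filter, Finset.mem_range]
    omega
  rw [Finset.sum_congr rfl h1, ← h]
  refine Finset.sum_congr rfl fun k _ => ?_
  rw [Finset.mul_sum, Finset.mul_sum]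
  refine Finset.sum_congr rfl fun j hj => ?_
  rw [Nat.add_sub_cancel' (Nat.lt_succ_iff.1 (Finset.mem_range.1 hj))]
  simp only [← inv_pow]
  ring

/-- With `u = 1/(z - z_α)` and `v = 1/(w - z_α)`, one has `u v (w - z) = u - v`, and the geometric
sum telescopes to `u^(k+1) - v^(k+1)`. The constant `ℓ^∞` cancels in the difference. -/
lemma dividedTwist_mul_sub {z w : ℂ} (hz : ∀ α, z ≠ D.pos α) (hw : ∀ α, w ≠ D.pos α) :
    D.dividedTwist z w * (w - z) = D.twist z - D.twist w := by
  rw [dividedTwist_eq, twist, twist, sub_sub_sub_cancel_right, ← Finset.sum_sub_distrib,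
    Finset.sum_mul]
  refine Finset.sum_congr rfl fun α _ => ?_
  rw [← Finset.sum_sub_distrib, Finset.sum_mul]
  refine Finset.sum_congr rfl fun k _ => ?_
  have h := geom_sum₂_mul (z - D.pos α)⁻¹ (w - D.pos α)⁻¹ (k + 1)
  rw [Nat.add_sub_cancel] at h
  have hz' := sub_ne_zero.2 (hz α)
  have hw' := sub_ne_zero.2 (hw α)
  have e : (z - D.pos α)⁻¹ * (w - D.pos α)⁻¹ * (w - z)
      = (z - D.pos α)⁻¹ - (w - D.pos α)⁻¹ := by
    field_simp
    ring
  rw [div_eq_mul_inv, div_eq_mul_inv, ← inv_pow, ← inv_pow, ← mul_sub, ← h, ← e]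
  ring

/-- The product identity is void at `w = z`. Instead the `k + 1` equal terms of the geometric sum
give `(k + 1) u^(k+2)`, minus the derivative of `u^(k+1)`. -/
lemma dividedTwist_self {z : ℂ} (hz : ∀ α, z ≠ D.pos α) :
    D.dividedTwist z z = -deriv D.twist z := by
  have hd : HasDerivAt D.twist (∑ α, ∑ k ∈ Finset.range (D.m α),
      -(D.lev α k * ((k + 1) * (z - D.pos α)⁻¹ ^ (k + 2)))) z := by
    refine HasDerivAt.sub_const _ (HasDerivAt.fun_sum fun α _ => HasDerivAt.fun_sum fun k _ => ?_)
    have hz' := sub_ne_zero.2 (hz α)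
    have h := ((((hasDerivAt_id z).sub_const (D.pos α)).fun_pow (k + 1)).fun_inv
      (pow_ne_zero _ hz')).const_mul (D.lev α k)
    simp only [div_eq_mul_inv]
    refine h.congr_deriv ?_
    simp only [id, Nat.add_sub_cancel, inv_pow]
    push_cast
    field_simp
    ring
  rw [hd.deriv, dividedTwist_eq, ← Finset.sum_neg_distrib]
  refine Finset.sum_congr rfl fun α _ => ?_
  rw [← Finset.sum_neg_distrib]
  refine Finset.sum_congr rfl fun k _ => ?_
  have h : ∑ j ∈ Finset.range (k + 1), (z - D.pos α)⁻¹ ^ j * (z - D.pos α)⁻¹ ^ (k - j)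
      = (k + 1) * (z - D.pos α)⁻¹ ^ k := by
    rw [Finset.sum_congr rfl fun j hj => by
      rw [← pow_add, Nat.add_sub_cancel' (Nat.lt_succ_iff.1 (Finset.mem_range.1 hj))]]
    simp
  rw [h, neg_neg]
  ring

variable {D}

lemma IsZeros.ne_pos {ζ : Fin D.M → ℂ} (hζ : D.IsZeros ζ) (i : Fin D.M) (α : S) :
    ζ i ≠ D.pos α :=
  ((hζ.zero_iff (ζ i)).2 ⟨i, rfl⟩).1 α

/-- This orthogonality decouples currents at distinct zeros to first order. -/
lemma IsZeros.dividedTwist_eq {ζ : Fin D.M → ℂ} (hζ : D.IsZeros ζ) (i j : Fin D.M) :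
    D.dividedTwist (ζ i) (ζ j) = if i = j then -deriv D.twist (ζ i) else 0 := by
  split_ifs with h
  · rw [← h, D.dividedTwist_self (hζ.ne_pos i)]
  · have h1 := D.dividedTwist_mul_sub (hζ.ne_pos i) (hζ.ne_pos j)
    rw [((hζ.zero_iff (ζ i)).2 ⟨i, rfl⟩).2, ((hζ.zero_iff (ζ j)).2 ⟨j, rfl⟩).2, sub_zero] at h1
    exact (mul_eq_zero.1 h1).resolve_right
      (sub_ne_zero.2 fun h' => h (hζ.injective h'.symm))

end Params

/-! ### Brackets of the Gaudin Lax matrix -/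

namespace Realisation

variable {𝔤 : Type*} [LieRing 𝔤] [LieAlgebra ℂ 𝔤] [FiniteDimensional ℂ 𝔤]
  [LieAlgebra.IsSimple ℂ 𝔤] {n : ℕ} {S : Type*} [Fintype S]
  {E : RealBasis 𝔤 n} {D : Params S} {V : Type*} [CommRing V] [Algebra ℂ V]
  [StarRing V] [LocalPoissonAlgebra V] (R : Realisation E D V)

-- The commutator term has order zero in `λ`, so first order sees only the levels, with constant
-- coefficients.
open scoped Classical in
lemma br_J_cases {α β : S} {p q : ℕ} (hp : p < D.m α) (hq : q < D.m β) (a b : Fin n) :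
    (br (R.J α p a) (R.J β q b)).natDegree ≤ 1 ∧ (br (R.J α p a) (R.J β q b)).coeff 1 =
      if α = β then if p + q < D.m α then
        algebraMap ℂ V (D.lev α (p + q) * E.comp₂ E.casimir a b) else 0 else 0 := by
  by_cases h : α = β ∧ p + q < D.m α
  · obtain ⟨rfl, h⟩ := h
    rw [R.bracket_same α p q a b h, if_pos rfl, if_pos h]
    refine ⟨?_, ?_⟩
    · refine (natDegree_add_le _ _).trans (max_le ((natDegree_C _).trans_le zero_le_one) ?_)
      exact (natDegree_smul_le _ _).trans natDegree_X_le
    · simp [Algebra.algebraMap_eq_smul_one]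
  · rw [R.bracket_zero α β p q a b hp hq (by by_contra hc; push Not at hc; exact h hc)]
    refine ⟨by simp, ?_⟩
    by_cases h1 : α = β
    · rw [if_pos h1, if_neg fun h2 => h ⟨h1, h2⟩, coeff_zero]
    · rw [if_neg h1, coeff_zero]

lemma natDegree_br_Γ_le (z w : ℂ) (a b : Fin n) :
    (br (R.Γ z a) (R.Γ w b)).natDegree ≤ 1 := by
  simp only [Γ, map_sum, map_smul, LinearMap.sum_apply, LinearMap.smul_apply]
  refine natDegree_sum_le_of_forall_le _ _ fun α _ => natDegree_sum_le_of_forall_le _ _ fun p hp =>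
    (natDegree_smul_le _ _).trans <| natDegree_sum_le_of_forall_le _ _ fun β _ =>
    natDegree_sum_le_of_forall_le _ _ fun q hq => (natDegree_smul_le _ _).trans ?_
  exact (R.br_J_cases (Finset.mem_range.1 ‹_›) (Finset.mem_range.1 ‹_›) a b).1

lemma coeff_one_br_Γ (z w : ℂ) (a b : Fin n) :
    (br (R.Γ z a) (R.Γ w b)).coeff 1
      = algebraMap ℂ V (D.dividedTwist z w * E.comp₂ E.casimir a b) := by
  classical
  rw [Params.dividedTwist, Finset.sum_mul, map_sum]
  simp only [Γ, map_sum, map_smul, LinearMap.sum_apply, LinearMap.smul_apply, finsetSum_coeff,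
    coeff_smul]
  refine Finset.sum_congr rfl fun α _ => ?_
  -- Expanding the bracket leaves the pole order of the second argument outermost, whereas
  -- `dividedTwist` has that of the first.
  conv_rhs => rw [Finset.sum_comm, Finset.sum_mul, map_sum]
  refine Finset.sum_congr rfl fun q hq => ?_
  rw [Finset.sum_eq_single α, Finset.sum_mul, map_sum, Finset.smul_sum]
  · refine Finset.sum_congr rfl fun p hp => ?_
    rw [(R.br_J_cases (Finset.mem_range.1 hp) (Finset.mem_range.1 hq) a b).2, if_pos rfl]
    split_ifs
    · rw [Algebra.smul_def, Algebra.smul_def, ← map_mul, ← map_mul]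
      ring_nf
    · simp
  · intro β _ hβ
    refine Finset.sum_eq_zero fun p hp => ?_
    rw [(R.br_J_cases (Finset.mem_range.1 hp) (Finset.mem_range.1 hq) a b).2, if_neg hβ,
      smul_zero]
  · simp

lemma coeff_one_br_q_Γ {ζ : Fin D.M → ℂ} (hζ : D.IsZeros ζ) (i j : Fin D.M) (a : Fin n) :
    (br (R.q ζ j) (R.Γ (ζ i) a)).coeff 1 = if i = j then R.Γ (ζ i) a else 0 := by
  have h : ∀ b c, (br (R.Γ (ζ j) b * R.Γ (ζ j) c) (R.Γ (ζ i) a)).coeff 1 =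
      D.dividedTwist (ζ i) (ζ j) • (E.comp₂ E.casimir a b • R.Γ (ζ j) c
        + E.comp₂ E.casimir a c • R.Γ (ζ j) b) := by
    intro b c
    -- The Leibniz rule is available in the right argument only. The swap moves the product there
    -- without a sign, provided the order is at most one, which is checked last.
    rw [coeff_one_br_swap, leibniz, coeff_add, coeff_mul_C, coeff_C_mul, coeff_one_br_Γ,
      coeff_one_br_Γ, smul_add, smul_smul, smul_smul, ← Algebra.smul_def, mul_comm (R.Γ (ζ j) b),
      ← Algebra.smul_def]
    rw [leibniz]
    refine (natDegree_add_le _ _).trans (max_le ?_ ?_)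
    · exact (natDegree_mul_C_le _ _).trans (R.natDegree_br_Γ_le _ _ _ _)
    · exact (natDegree_C_mul_le _ _).trans (R.natDegree_br_Γ_le _ _ _ _)
  have h2 : (br (E.kappaField (R.Γ (ζ j)) (R.Γ (ζ j))) (R.Γ (ζ i) a)).coeff 1 =
      D.dividedTwist (ζ i) (ζ j) • (2 : ℂ) • R.Γ (ζ j) a := by
    rw [← E.sum_kappa_casimir]
    simp only [RealBasis.kappaField, map_sum, map_smul, LinearMap.sum_apply,
      LinearMap.smul_apply, finsetSum_coeff, coeff_smul, h, Finset.smul_sum]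
    refine Finset.sum_congr rfl fun b _ => Finset.sum_congr rfl fun c _ => smul_comm _ _ _
  rw [q, map_smul, LinearMap.smul_apply, coeff_smul, h2, hζ.dividedTwist_eq]
  split_ifs with hij
  · subst hij
    -- The factor `-φ'(ζ_i)` comes from the diagonal divided difference and the `2` from polarising
    -- `κ`; the prefactor of `q_i` cancels both.
    have := hζ.simple i
    rw [smul_smul, smul_smul, mul_assoc, show -1 / (2 * deriv D.twist (ζ i)) * (-deriv D.twist (ζ i) * 2) = 1 by field_simp,
      one_smul]
  · simp

lemma coeff_one_br_energyDensity_Γ {ζ : Fin D.M → ℂ} (hζ : D.IsZeros ζ) (ε : Fin D.M → ℝ)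
    (i : Fin D.M) (a : Fin n) :
    (br (R.energyDensity ζ ε) (R.Γ (ζ i) a)).coeff 1 = (ε i : ℂ) • R.Γ (ζ i) a := by
  simp only [energyDensity, map_sum, map_smul, LinearMap.sum_apply, LinearMap.smul_apply,
    finsetSum_coeff, coeff_smul, R.coeff_one_br_q_Γ hζ]
  simp

lemma hamiltonian_eq_integral (ζ : Fin D.M → ℂ) (ε : Fin D.M → ℝ) :
    R.hamiltonian ζ ε = integral (R.energyDensity ζ ε) := by
  simp [hamiltonian, energyDensity, Q]

end Realisation

end AGM

end

theorem proposition2p5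
    {𝔤 : Type*} [LieRing 𝔤] [LieAlgebra ℂ 𝔤] [FiniteDimensional ℂ 𝔤] [LieAlgebra.IsSimple ℂ 𝔤]
    {n : ℕ} (E : AGM.RealBasis 𝔤 n)
    {S : Type*} [Fintype S] (D : AGM.Params S)
    {V : Type*} [CommRing V] [Algebra ℂ V] [StarRing V] [StarModule ℂ V]
    [AGM.LocalPoissonAlgebra V]
    (P : AGM.Charge V) (hP : AGM.IsMomentum P)
    (R : AGM.Realisation E D V) (hR : R.IsSuitable P)
    (ζ : Fin D.M → ℂ) (hζ : D.IsZeros ζ)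
    (ε : Fin D.M → ℝ) (hε : ∀ i, ε i = 1 ∨ ε i = -1) :
    (∀ (i : Fin D.M) (a : Fin n),
      AGM.HasSpin (R.boost P ζ ε) (R.hamiltonian ζ ε) (ε i) (R.Γ (ζ i) a)) ∧
    (∀ (i : Fin D.M) (d : ℕ) (Φ : MvPolynomial (Fin n) ℂ),
      Φ.IsHomogeneous (d + 1) → E.IsInvariant Φ →
        R.hierarchyCharge ζ i d Φ = AGM.integral (R.hierarchyDensity ζ i d Φ) ∧
        AGM.HasSpin (R.boost P ζ ε) (R.hamiltonian ζ ε) (ε i * (d + 1))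
          (R.hierarchyDensity ζ i d Φ)) := by
  -- The Hamiltonian and the boost are now written with the same density, as the spin criterion
  -- requires.
  rw [R.hamiltonian_eq_integral]
  refine ⟨fun i a => AGM.hasSpin_of_coeff_one hP _ _ _ (R.coeff_one_br_energyDensity_Γ hζ ε i a),
    fun i d Φ hΦ _ => ⟨(map_smul _ _ _).symm, AGM.hasSpin_of_coeff_one hP _ _ _ ?_⟩⟩
  have h := AGM.derivation_aeval_of_isHomogeneous (AGM.brCoeff (R.energyDensity ζ ε) 1)
    (R.Γ (ζ i)) (ε i) (R.coeff_one_br_energyDensity_Γ hζ ε i) hΦ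
  rw [← AGM.brCoeff_apply, AGM.Realisation.hierarchyDensity, Derivation.map_smul, h, smul_comm]
  push_cast
  rfl
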